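/- Let $a\in\mathbb R$ and $L>0$. Consider the stationary KdV boundary value problem $$u'''+au'+uu'=0 \ \text{ on } [0,L],\qquad u(0)=u(L)=u'(L)=0,$$ for real-valued $u\in C^3[0,L]$ (with one-sided derivatives at the endpoints). For a solution $u$, let $\tilde u:\mathbb R\to\mathbb R$ be its extension with period $L$ (well defined since $u(0)=u(L)$); the fundamental period of $u$ is the smallest $T>0$ such that $\tilde u(x+T)=\tilde u(x)$ for all $x\in\mathbb R$. If $aL^2\ne 4\pi^2$, then there exists exactly one nontrivial (not identically zero) solution $u$ of this problem whose fundamental period is exactly $L$. If $aL^2=4\pi^2$, no nontrivial solution with fundamental period $L$ exists. -/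

import Mathlib

open Set Real

noncomputable section

/-- `u`, viewed as a function on `[0, L]`, is a classical solution (of class `C³` up to the
endpoints) of `u''' + a u' + u u' = 0` on `[0, L]` with `u(0) = u(L) = u'(L) = 0`.
Derivatives are taken within `[0, L]`, hence are one-sided at the endpoints, and the values of `u`
outside `[0, L]` are irrelevant. -/
structure IsStationaryKdVSolution (a L : ℝ) (u : ℝ → ℝ) : Prop where
  contDiffOn : ContDiffOn ℝ 3 u (Icc 0 L)
  equation : ∀ x ∈ Icc 0 L,
    iteratedDerivWithin 3 u (Icc 0 L) x + a * derivWithin u (Icc 0 L) x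
      + u x * derivWithin u (Icc 0 L) x = 0
  left_value : u 0 = 0
  right_value : u L = 0
  right_deriv : derivWithin u (Icc 0 L) L = 0

/-- `T` is the fundamental period of `v : ℝ → ℝ`: the least positive period. -/
def IsFundamentalPeriod (v : ℝ → ℝ) (T : ℝ) : Prop :=
  IsLeast {S : ℝ | 0 < S ∧ Function.Periodic v S} T

/-- The extension to the whole line, with period `L > 0`, of the restriction of `u` to `[0, L)`
(it agrees with `u` on all of `[0, L]` when `u 0 = u L`). -/
def periodicExtension (L : ℝ) (u : ℝ → ℝ) : ℝ → ℝ :=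
  fun x => u (L * Int.fract (x / L))

/-- `u` is a nontrivial solution of the boundary value problem on `[0, L]` whose fundamental
period, as an `L`-periodic function, is exactly `L`. -/
structure IsFundamentalKdVSolution (a L : ℝ) (u : ℝ → ℝ) : Prop where
  solution : IsStationaryKdVSolution a L u
  nontrivial : ∃ x ∈ Icc 0 L, u x ≠ 0
  fundamentalPeriod : IsFundamentalPeriod (periodicExtension L u) L

end

/-! Integrating twice gives `u'' = c - a u - u² / 2` and `u'² = u (2c - a u - u² / 3)`, the second
constant vanishing because `u(L) = u'(L) = 0`. If `ρ ≠ 0` is the value of `u` where `|u|` is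
largest, then `c = ρ (ρ + 3a) / 6` and `u'² = u (ρ - u) (3a + ρ + u) / 3`. Substituting `u = ρ sin²
φ` turns this into `φ'² = (3a + ρ + ρ sin² φ) / 12`, so the fundamental period is `T(ρ) = ∫₀^π dθ /
φ'(θ)`, i.e. `phasePeriod`.

On the admissible ray of `ρ`, `T` is continuous, strictly decreasing, and takes arbitrarily large
and arbitrarily small values, so `T(ρ) = L` has exactly one root. It gives a nontrivial solution
unless it is `ρ = 0`; as `T(0) = 2π / √a`, this happens exactly when `a L² = 4π²`. Conversely,
`IsFundamentalKdVSolution.exists_amplitude` shows that every fundamental solution arises in this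
way. -/

/-! ### The angular speed and the period integral -/

/-- The speed of the phase `φ` in the parametrization `u = ρ sin² φ`, where `A = 3a + ρ` and
`B = 3a + 2ρ`. -/
noncomputable def angularSpeed (A B θ : ℝ) : ℝ := √((A * cos θ ^ 2 + B * sin θ ^ 2) / 12)

/-- The time in which the phase grows by `π`. -/
noncomputable def phasePeriod (A B : ℝ) : ℝ := ∫ θ in (0 : ℝ)..π, (angularSpeed A B θ)⁻¹

lemma quadratic_cos_sin_pos {A B : ℝ} (hA : 0 < A) (hB : 0 < B) (θ : ℝ) :
    0 < (A * cos θ ^ 2 + B * sin θ ^ 2) / 12 := by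
  have h := sin_sq_add_cos_sq θ
  have hc := sq_nonneg (cos θ)
  have hs := sq_nonneg (sin θ)
  rcases hs.eq_or_lt with h0 | h0
  · rw [← h0] at h ⊢
    rw [show cos θ ^ 2 = 1 by linarith]
    linarith
  · have := mul_pos hB h0
    have := mul_nonneg hA.le hc
    linarith

lemma angularSpeed_pos {A B : ℝ} (hA : 0 < A) (hB : 0 < B) (θ : ℝ) :
    0 < angularSpeed A B θ :=
  Real.sqrt_pos.2 (quadratic_cos_sin_pos hA hB θ)

lemma sq_angularSpeed {A B : ℝ} (hA : 0 < A) (hB : 0 < B) (θ : ℝ) :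
    angularSpeed A B θ ^ 2 = (A * cos θ ^ 2 + B * sin θ ^ 2) / 12 :=
  Real.sq_sqrt (quadratic_cos_sin_pos hA hB θ).le

lemma continuous_angularSpeed (A B : ℝ) : Continuous (angularSpeed A B) := by
  unfold angularSpeed
  fun_prop

lemma continuous_inv_angularSpeed {A B : ℝ} (hA : 0 < A) (hB : 0 < B) :
    Continuous fun θ => (angularSpeed A B θ)⁻¹ :=
  (continuous_angularSpeed A B).inv₀ fun θ => (angularSpeed_pos hA hB θ).ne'

lemma angularSpeed_periodic (A B : ℝ) : Function.Periodic (angularSpeed A B) π := by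
  intro θ
  simp [angularSpeed, cos_add_pi, sin_add_pi]

lemma inv_angularSpeed_periodic (A B : ℝ) :
    Function.Periodic (fun θ => (angularSpeed A B θ)⁻¹) π := by
  intro θ
  simp only [angularSpeed_periodic A B θ]

lemma phasePeriod_pos {A B : ℝ} (hA : 0 < A) (hB : 0 < B) : 0 < phasePeriod A B :=
  intervalIntegral.intervalIntegral_pos_of_pos
    ((continuous_inv_angularSpeed hA hB).intervalIntegrable _ _)
    (fun θ => inv_pos.2 (angularSpeed_pos hA hB θ)) pi_pos

/-- A shift by `π / 2` swaps `sin²` and `cos²`. This lets one divergence estimate serve for either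
coefficient tending to zero. -/
lemma phasePeriod_comm (A B : ℝ) : phasePeriod A B = phasePeriod B A := by
  have h := (inv_angularSpeed_periodic A B).intervalIntegral_add_eq 0 (π / 2)
  have h2 := intervalIntegral.integral_comp_add_right (a := (0 : ℝ)) (b := π)
    (fun θ => (angularSpeed A B θ)⁻¹) (π / 2)
  rw [zero_add] at h h2
  rw [phasePeriod, h, phasePeriod, add_comm (π / 2) π, ← h2]
  congr 1
  ext θ
  simp [angularSpeed, cos_add_pi_div_two, sin_add_pi_div_two, add_comm]

lemma phasePeriod_self {A : ℝ} : phasePeriod A A = π * (√(A / 12))⁻¹ := by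
  have h : ∀ θ, angularSpeed A A θ = √(A / 12) := fun θ => by
    rw [angularSpeed, ← mul_add, cos_sq_add_sin_sq, mul_one]
  simp [phasePeriod, h, mul_div_assoc]

lemma angularSpeed_lt {A B A' B' : ℝ} (hA : 0 < A) (hB : 0 < B) (hA' : A < A') (hB' : B < B')
    (θ : ℝ) : angularSpeed A B θ < angularSpeed A' B' θ := by
  refine Real.sqrt_lt_sqrt (quadratic_cos_sin_pos hA hB θ).le ?_
  have := quadratic_cos_sin_pos (sub_pos.2 hA') (sub_pos.2 hB') θ
  linarith

lemma phasePeriod_lt {A B A' B' : ℝ} (hA : 0 < A) (hB : 0 < B) (hA' : A < A') (hB' : B < B') :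
    phasePeriod A' B' < phasePeriod A B := by
  have hlt : ∀ θ, (angularSpeed A' B' θ)⁻¹ < (angularSpeed A B θ)⁻¹ := fun θ =>
    (inv_lt_inv₀ (angularSpeed_pos (hA.trans hA') (hB.trans hB') θ) (angularSpeed_pos hA hB θ)).2
      (angularSpeed_lt hA hB hA' hB' θ)
  exact intervalIntegral.integral_lt_integral_of_continuousOn_of_le_of_exists_lt pi_pos
    (continuous_inv_angularSpeed (hA.trans hA') (hB.trans hB')).continuousOn
    (continuous_inv_angularSpeed hA hB).continuousOn (fun θ _ => (hlt θ).le)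
    ⟨0, ⟨le_rfl, pi_pos.le⟩, hlt 0⟩

/-- The period is unbounded as one of the two coefficients tends to zero. -/
lemma exists_le_phasePeriod (K M : ℝ) (hK : 0 < K) :
    ∃ ε₀ > 0, ∀ A B : ℝ, 0 < A → A ≤ ε₀ → 0 < B → B ≤ K → M ≤ phasePeriod A B := by
  have hC : 0 < √((1 + K) / 12) := Real.sqrt_pos.2 (by positivity)
  set C := √((1 + K) / 12) with hCdef
  -- Chosen so that `∫ dθ / (C θ)` over `[δ, π]` equals `log (π / δ) / C = |M|`. There `A ≤ δ² ≤ θ²`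
  -- bounds the speed by `C θ`.
  set δ := π * exp (-(C * |M|)) with hδ
  have hδ0 : 0 < δ := by positivity
  have hδπ : δ ≤ π := by
    have : exp (-(C * |M|)) ≤ 1 := Real.exp_le_one_iff.2 (by have := abs_nonneg M; nlinarith)
    nlinarith [pi_pos]
  refine ⟨δ ^ 2, by positivity, fun A B hA hAε hB hBK => ?_⟩
  have hInt : ∀ x y : ℝ, IntervalIntegrable (fun θ => (angularSpeed A B θ)⁻¹)
      MeasureTheory.volume x y := fun x y =>
    (continuous_inv_angularSpeed hA hB).intervalIntegrable x y
  have h1 : ∫ θ in δ..π, (angularSpeed A B θ)⁻¹ ≤ phasePeriod A B := by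
    rw [phasePeriod, ← intervalIntegral.integral_add_adjacent_intervals (hInt 0 δ) (hInt δ π)]
    have := intervalIntegral.integral_nonneg (μ := MeasureTheory.volume) hδ0.le
      fun θ _ => (inv_pos.2 (angularSpeed_pos hA hB θ)).le
    linarith
  have h2 : ∫ θ in δ..π, C⁻¹ * θ⁻¹ ≤ ∫ θ in δ..π, (angularSpeed A B θ)⁻¹ := by
    refine intervalIntegral.integral_mono_on hδπ ?_ (hInt _ _) fun θ hθ => ?_
    · refine ContinuousOn.intervalIntegrable (ContinuousOn.mul continuousOn_const ?_)
      refine continuousOn_id.inv₀ fun θ hθ => ?_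
      rw [uIcc_of_le hδπ] at hθ
      exact (hδ0.trans_le hθ.1).ne'
    · have hθ0 : 0 < θ := hδ0.trans_le hθ.1
      rw [← mul_inv]
      refine inv_anti₀ (angularSpeed_pos hA hB θ) ?_
      rw [angularSpeed, Real.sqrt_le_left (by positivity), mul_pow, hCdef,
        Real.sq_sqrt (by positivity)]
      have hs : sin θ ^ 2 ≤ θ ^ 2 := by
        rw [sq_le_sq]
        exact Real.abs_sin_le_abs
      have hc : cos θ ^ 2 ≤ 1 := Real.cos_sq_le_one θ
      have hδθ : δ ^ 2 ≤ θ ^ 2 := by gcongr; exact hθ.1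
      have e1 : A * cos θ ^ 2 ≤ θ ^ 2 * 1 := by
        gcongr
        exact hAε.trans hδθ
      have e2 : B * sin θ ^ 2 ≤ K * θ ^ 2 := by gcongr
      linarith
  have h3 : ∫ θ in δ..π, C⁻¹ * θ⁻¹ = |M| := by
    rw [intervalIntegral.integral_const_mul, integral_inv_of_pos hδ0 pi_pos, hδ,
      div_mul_cancel_left₀ pi_pos.ne', ← Real.exp_neg, neg_neg, Real.log_exp]
    field_simp
  linarith [le_abs_self M]

lemma phasePeriod_le {A B m : ℝ} (hm : 0 < m) (hA : m < A) (hB : m < B) :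
    phasePeriod A B ≤ π * (√(m / 12))⁻¹ := by
  rw [← phasePeriod_self]
  exact (phasePeriod_lt hm hm hA hB).le

/-- Amplitudes `ρ` for which the two coefficients of the angular speed are positive. -/
def admissibleAmplitudes (a : ℝ) : Set ℝ := {ρ | 0 < 3 * a + ρ ∧ 0 < 3 * a + 2 * ρ}

lemma phasePeriod_strictAntiOn (a : ℝ) :
    StrictAntiOn (fun ρ => phasePeriod (3 * a + ρ) (3 * a + 2 * ρ)) (admissibleAmplitudes a) :=
  fun _ hρ _ _ h => phasePeriod_lt hρ.1 hρ.2 (by linarith) (by linarith)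

lemma continuousOn_phasePeriod (a : ℝ) :
    ContinuousOn (fun ρ => phasePeriod (3 * a + ρ) (3 * a + 2 * ρ)) (admissibleAmplitudes a) := by
  rw [continuousOn_iff_continuous_domRestrict]
  refine intervalIntegral.continuous_parametric_intervalIntegral_of_continuous'
    (f := fun (ρ : admissibleAmplitudes a) θ =>
      (angularSpeed (3 * a + ρ) (3 * a + 2 * ρ) θ)⁻¹) ?_ 0 π
  refine Continuous.inv₀ ?_ fun p => (angularSpeed_pos p.1.2.1 p.1.2.2 p.2).ne'
  unfold angularSpeed
  fun_prop

lemma convex_admissibleAmplitudes (a : ℝ) : Convex ℝ (admissibleAmplitudes a) := by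
  rintro x ⟨hx1, hx2⟩ y ⟨hy1, hy2⟩ s t hs ht hst
  have hs' : s = 1 - t := by linarith
  subst hs'
  simp only [smul_eq_mul, admissibleAmplitudes, mem_ofPred_eq]
  rcases ht.eq_or_lt with rfl | ht
  · constructor <;> linarith
  · constructor <;> nlinarith

lemma exists_admissible_le_phasePeriod (a L : ℝ) :
    ∃ ρ ∈ admissibleAmplitudes a, L ≤ phasePeriod (3 * a + ρ) (3 * a + 2 * ρ) := by
  have hK : 0 < 3 * |a| + 2 := by positivity
  obtain ⟨ε₀, hε₀, h⟩ := exists_le_phasePeriod (3 * |a| + 2) L hK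
  have hε : 0 < min ε₀ 1 := lt_min hε₀ one_pos
  have hε1 : min ε₀ 1 ≤ 1 := min_le_right _ _
  have hε2 : min ε₀ 1 ≤ ε₀ := min_le_left _ _
  generalize min ε₀ 1 = ε at *
  -- The constraint that binds is `3a + ρ > 0` for `a ≤ 0` and `3a + 2ρ > 0` for `a > 0`; the
  -- witness makes that coefficient equal to `ε`.
  rcases le_or_gt a 0 with ha | ha
  · rw [abs_of_nonpos ha] at h
    refine ⟨-3 * a + ε, ⟨by linarith, by linarith⟩, h _ _ ?_ ?_ ?_ ?_⟩ <;> linarith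
  · rw [abs_of_pos ha] at h
    refine ⟨-3 * a / 2 + ε / 2, ⟨by linarith, by linarith⟩, ?_⟩
    rw [phasePeriod_comm]
    refine h _ _ ?_ ?_ ?_ ?_ <;> linarith

lemma exists_admissible_phasePeriod_le (a : ℝ) {L : ℝ} (hL : 0 < L) :
    ∃ ρ ∈ admissibleAmplitudes a, phasePeriod (3 * a + ρ) (3 * a + 2 * ρ) ≤ L := by
  have hm : 0 < 12 * (π / L) ^ 2 := by positivity
  have ha : -|a| ≤ a := neg_abs_le a
  -- Both coefficients then exceed `12 (π / L)²`, for which the constant-speed period is `L`.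
  refine ⟨12 * (π / L) ^ 2 + 3 * |a| + 1, ⟨by linarith, ?_⟩, ?_⟩
  · linarith [abs_nonneg a]
  · refine (phasePeriod_le hm (by linarith) (by linarith [abs_nonneg a])).trans_eq ?_
    rw [mul_div_cancel_left₀ _ (by norm_num), Real.sqrt_sq (by positivity)]
    field_simp

lemma exists_admissible_phasePeriod_eq (a : ℝ) {L : ℝ} (hL : 0 < L) :
    ∃ ρ ∈ admissibleAmplitudes a, phasePeriod (3 * a + ρ) (3 * a + 2 * ρ) = L := by
  obtain ⟨ρ₁, h₁, hle₁⟩ := exists_admissible_phasePeriod_le a hL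
  obtain ⟨ρ₂, h₂, hle₂⟩ := exists_admissible_le_phasePeriod a L
  exact (convex_admissibleAmplitudes a).isPreconnected.intermediate_value h₁ h₂
    (continuousOn_phasePeriod a) ⟨hle₁, hle₂⟩

lemma phasePeriod_zero_amplitude_eq_iff {a L : ℝ} (ha : 0 < a) (hL : 0 < L) :
    phasePeriod (3 * a + 0) (3 * a + 2 * 0) = L ↔ a * L ^ 2 = 4 * π ^ 2 := by
  rw [mul_zero, add_zero, phasePeriod_self, ← div_eq_mul_inv,
    div_eq_iff (Real.sqrt_pos.2 (by positivity)).ne',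
    ← sq_eq_sq₀ pi_pos.le (by positivity), mul_pow, Real.sq_sqrt (by positivity)]
  constructor <;> intro h <;> linarith

/-! ### The phase and the periodic profile -/

/-- The phase: the solution of `φ' = angularSpeed A B φ`, `φ 0 = 0`. -/
lemma exists_phase {A B : ℝ} (hA : 0 < A) (hB : 0 < B) :
    ∃ φ : ℝ → ℝ, φ 0 = 0 ∧ StrictMono φ ∧ (∀ x, HasDerivAt φ (angularSpeed A B (φ x)) x) ∧
      ∀ x, φ (x + phasePeriod A B) = φ x + π := by
  set h : ℝ → ℝ := fun θ => (angularSpeed A B θ)⁻¹ with hh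
  have hcont : Continuous h := continuous_inv_angularSpeed hA hB
  have hpos : ∀ θ, 0 < h θ := fun θ => inv_pos.2 (angularSpeed_pos hA hB θ)
  have hper : Function.Periodic h π := inv_angularSpeed_periodic A B
  have hInt : ∀ x y : ℝ, IntervalIntegrable h MeasureTheory.volume x y :=
    fun x y => hcont.intervalIntegrable x y
  set F : ℝ → ℝ := fun y => ∫ θ in (0 : ℝ)..y, h θ with hF
  have hder : ∀ y, HasDerivAt F (h y) y := fun y => hcont.integral_hasStrictDerivAt 0 y |>.hasDerivAt
  have hmono : StrictMono F := strictMono_of_hasDerivAt_pos hder hpos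
  have hFcont : Continuous F := continuous_iff_continuousAt.2 fun y => (hder y).continuousAt
  have hT : 0 < ∫ θ in (0 : ℝ)..π, h θ := phasePeriod_pos hA hB
  -- The phase is the inverse of the time `F`, which is onto because each period of the integrand
  -- adds the same positive amount.
  have hsurj : Function.Surjective F := hFcont.surjective
    (hper.tendsto_atTop_intervalIntegral_of_pos hT pi_pos)
    (hper.tendsto_atBot_intervalIntegral_of_pos hT pi_pos)
  have hshift : ∀ y, F (y + π) = F y + phasePeriod A B := fun y => by
    have h1 := intervalIntegral.integral_add_adjacent_intervals (hInt 0 y) (hInt y (y + π))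
    have h2 := hper.intervalIntegral_add_eq y 0
    rw [zero_add] at h2
    rw [h2] at h1
    exact h1.symm
  let e := hmono.orderIsoOfSurjective F hsurj
  have heF : ∀ y, e.symm (F y) = y := fun y => e.symm_apply_apply y
  have hFe : ∀ x, F (e.symm x) = x := fun x => e.apply_symm_apply x
  refine ⟨e.symm, ?_, e.symm.strictMono, fun x => ?_, fun x => ?_⟩
  · have : F 0 = 0 := by simp [hF]
    simpa [this] using heF 0
  · have := (hder (e.symm x)).of_local_left_inverse e.symm.continuous.continuousAt (hpos _).ne'
      (Filter.Eventually.of_forall hFe)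
    simpa [hh] using this
  · rw [← heF (e.symm x + π), hshift, hFe]

/-- For each admissible amplitude, the solution of `u'' = c - a u - u² / 2`, `u 0 = u' 0 = 0`,
with `c = ρ (ρ + 3 a) / 6`. -/
lemma exists_profile {a ρ : ℝ} (hρ : ρ ∈ admissibleAmplitudes a) (hρ0 : ρ ≠ 0) :
    ∃ u v : ℝ → ℝ, (∀ x, HasDerivAt u (v x) x) ∧
      (∀ x, HasDerivAt v (ρ * (ρ + 3 * a) / 6 - a * u x - u x ^ 2 / 2) x) ∧
      u 0 = 0 ∧ v 0 = 0 ∧ Function.Periodic u (phasePeriod (3 * a + ρ) (3 * a + 2 * ρ)) ∧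
      Function.Periodic v (phasePeriod (3 * a + ρ) (3 * a + 2 * ρ)) ∧
      ∀ x, 0 < x → x < phasePeriod (3 * a + ρ) (3 * a + 2 * ρ) → u x ≠ 0 := by
  obtain ⟨φ, hφ0, hmono, hder, hper⟩ := exists_phase hρ.1 hρ.2
  set S := angularSpeed (3 * a + ρ) (3 * a + 2 * ρ) with hS
  have hsq : ∀ θ, S θ ^ 2 = ((3 * a + ρ) * cos θ ^ 2 + (3 * a + 2 * ρ) * sin θ ^ 2) / 12 :=
    sq_angularSpeed hρ.1 hρ.2
  have hSpos : ∀ θ, 0 < S θ := angularSpeed_pos hρ.1 hρ.2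
  have hsin : ∀ x, HasDerivAt (fun x => sin (φ x)) (cos (φ x) * S (φ x)) x :=
    fun x => (hder x).sin
  have hcos : ∀ x, HasDerivAt (fun x => cos (φ x)) (-sin (φ x) * S (φ x)) x :=
    fun x => (hder x).cos
  have hspeed : ∀ x, HasDerivAt (fun x => S (φ x)) (ρ * sin (φ x) * cos (φ x) / 12) x := by
    intro x
    have h1 := ((((hcos x).fun_pow 2).const_mul (3 * a + ρ)).fun_add
      (((hsin x).fun_pow 2).const_mul (3 * a + 2 * ρ))).div_const 12
    have h2 := h1.sqrt (quadratic_cos_sin_pos hρ.1 hρ.2 (φ x)).ne'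
    refine h2.congr_deriv ?_
    change _ / (2 * S (φ x)) = _
    have := (hSpos (φ x)).ne'
    field_simp
    ring
  refine ⟨fun x => ρ * sin (φ x) ^ 2, fun x => 2 * ρ * (sin (φ x) * cos (φ x) * S (φ x)),
    fun x => ?_, fun x => ?_, by simp [hφ0], by simp [hφ0], fun x => ?_, fun x => ?_,
    fun x h0 hx => ?_⟩
  · refine (((hsin x).fun_pow 2).const_mul ρ).congr_deriv ?_
    ring
  · refine ((((hsin x).fun_mul (hcos x)).fun_mul (hspeed x)).const_mul (2 * ρ)).congr_deriv ?_
    have h := hsq (φ x)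
    have hc : cos (φ x) ^ 2 = 1 - sin (φ x) ^ 2 := Real.cos_sq' _
    rw [hc] at h
    linear_combination 2 * ρ * (cos (φ x) ^ 2 - sin (φ x) ^ 2) * h +
      (2 * ρ * ((3 * a + ρ) * (1 - sin (φ x) ^ 2) + (3 * a + 2 * ρ) * sin (φ x) ^ 2) / 12 +
        ρ ^ 2 * sin (φ x) ^ 2 / 6) * hc
  · simp only [hper, sin_add_pi, neg_sq]
  · have : S (φ x + π) = S (φ x) := angularSpeed_periodic _ _ _
    simp only [hper, sin_add_pi, cos_add_pi, this]
    ring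
  · have h1 : 0 < φ x := by
      rw [← hφ0]
      exact hmono h0
    have h2 : φ x < π := by
      have h3 := hper 0
      rw [hφ0, zero_add, zero_add] at h3
      rw [← h3]
      exact hmono hx
    exact mul_ne_zero hρ0 (pow_ne_zero 2 (sin_pos_of_pos_of_lt_pi h1 h2).ne')

lemma periodicExtension_eq {L : ℝ} (hL : 0 < L) {u w : ℝ → ℝ} (hper : Function.Periodic u L)
    (h : EqOn w u (Icc 0 L)) : periodicExtension L w = u := by
  ext x
  have h0 := Int.fract_nonneg (x / L)
  have h1 := (Int.fract_lt_one (x / L)).le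
  rw [periodicExtension, h ⟨by positivity, by nlinarith⟩, Int.fract, mul_sub,
    mul_div_cancel₀ _ hL.ne', mul_comm L]
  exact hper.sub_int_mul_eq _

lemma isFundamentalPeriod_of_ne_zero {u : ℝ → ℝ} {T : ℝ} (hT : 0 < T)
    (hper : Function.Periodic u T) (h0 : u 0 = 0) (hne : ∀ x, 0 < x → x < T → u x ≠ 0) :
    IsFundamentalPeriod u T := by
  refine ⟨⟨hT, hper⟩, fun S hS => ?_⟩
  by_contra! hlt
  refine hne S hS.1 hlt ?_
  rw [← zero_add S, hS.2 0, h0]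

lemma isStationaryKdVSolution_of_hasDerivAt {a c L : ℝ} (hL : 0 < L) {u v : ℝ → ℝ}
    (hu : ∀ x, HasDerivAt u (v x) x)
    (hv : ∀ x, HasDerivAt v (c - a * u x - u x ^ 2 / 2) x)
    (h0 : u 0 = 0) (hL0 : u L = 0) (hvL : v L = 0) : IsStationaryKdVSolution a L u := by
  have hdu : deriv u = v := funext fun x => (hu x).deriv
  have hdv : deriv v = fun x => c - a * u x - u x ^ 2 / 2 := funext fun x => (hv x).deriv
  have hw : ∀ x, HasDerivAt (fun x => c - a * u x - u x ^ 2 / 2) (-(a * v x) - u x * v x) x := by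
    intro x
    refine ((((hu x).const_mul a).const_sub c).fun_sub (((hu x).fun_pow 2).div_const 2)).congr_deriv
      ?_
    ring
  have hud : Differentiable ℝ u := fun x => (hu x).differentiableAt
  have hvd : Differentiable ℝ v := fun x => (hv x).differentiableAt
  have hu1 : ContDiff ℝ 1 u := by
    rw [contDiff_one_iff_deriv, hdu]
    exact ⟨hud, hvd.continuous⟩
  have hv2 : ContDiff ℝ 2 v := by
    rw [show (2 : WithTop ℕ∞) = 1 + 1 by norm_num, contDiff_succ_iff_deriv, hdv]
    exact ⟨hvd, by simp, by fun_prop⟩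
  have hu3 : ContDiff ℝ 3 u := by
    rw [show (3 : WithTop ℕ∞) = 2 + 1 by norm_num, contDiff_succ_iff_deriv, hdu]
    exact ⟨hud, by simp, hv2⟩
  have hU := uniqueDiffOn_Icc hL
  have hdw : ∀ x ∈ Icc 0 L, derivWithin u (Icc 0 L) x = v x := fun x hx =>
    (hu x).hasDerivWithinAt.derivWithin (hU x hx)
  refine ⟨hu3.contDiffOn, fun x hx => ?_, h0, hL0, ?_⟩
  · rw [iteratedDerivWithin_eq_iteratedDeriv hU hu3.contDiffAt hx, hdw x hx, iteratedDeriv_succ',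
      iteratedDeriv_succ', iteratedDeriv_one, hdu, hdv, (hw x).deriv]
    ring
  · rw [hdw L ⟨hL.le, le_rfl⟩, hvL]

/-! ### Uniqueness for the second order equation -/

/-- Grönwall in both directions: `E = d² + e²` satisfies `|E'| ≤ (1 + M) E`, so `E exp(±(1 + M) x)`
are monotone and antitone, which handles the points left and right of `x₀`. -/
lemma eqOn_zero_of_linear_second_order {L M : ℝ} {d e q : ℝ → ℝ}
    (hd : ∀ x ∈ Icc 0 L, HasDerivWithinAt d (e x) (Icc 0 L) x)
    (he : ∀ x ∈ Icc 0 L, HasDerivWithinAt e (q x * d x) (Icc 0 L) x)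
    (hq : ∀ x ∈ Icc 0 L, |q x| ≤ M) {x₀ : ℝ} (hx₀ : x₀ ∈ Icc 0 L)
    (hd0 : d x₀ = 0) (he0 : e x₀ = 0) : ∀ x ∈ Icc 0 L, d x = 0 := by
  have hE : ∀ k : ℝ, ∀ x ∈ Icc 0 L, HasDerivWithinAt
      (fun x => (d x ^ 2 + e x ^ 2) * exp (k * x))
      ((2 * (1 + q x) * (d x * e x) + k * (d x ^ 2 + e x ^ 2)) * exp (k * x)) (Icc 0 L) x := by
    intro k x hx
    refine ((((hd x hx).fun_pow 2).fun_add ((he x hx).fun_pow 2)).fun_mul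
      (((hasDerivWithinAt_id x _).const_mul k).exp)).congr_deriv ?_
    simp only [id]
    ring
  have hbound : ∀ x ∈ Icc 0 L,
      |2 * (1 + q x) * (d x * e x)| ≤ (1 + M) * (d x ^ 2 + e x ^ 2) := by
    intro x hx
    have h1 : |1 + q x| ≤ 1 + M := (abs_add_le _ _).trans (by rw [abs_one]; linarith [hq x hx])
    have h2 : 2 * |d x * e x| ≤ d x ^ 2 + e x ^ 2 := by
      rw [abs_mul, ← sq_abs (d x), ← sq_abs (e x)]
      nlinarith [sq_nonneg (|d x| - |e x|)]
    calc |2 * (1 + q x) * (d x * e x)| = |1 + q x| * (2 * |d x * e x|) := by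
          rw [abs_mul, abs_mul, abs_two]; ring
      _ ≤ _ := mul_le_mul h1 h2 (by positivity) ((abs_nonneg _).trans h1)
  have hmono : MonotoneOn (fun x => (d x ^ 2 + e x ^ 2) * exp ((1 + M) * x)) (Icc 0 L) := by
    refine monotoneOn_of_hasDerivWithinAt_nonneg (convex_Icc 0 L)
      (fun x hx => (hE _ x hx).continuousWithinAt)
      (fun x hx => (hE (1 + M) x (interior_subset hx)).mono interior_subset) fun x hx => ?_
    have := (abs_le.1 (hbound x (interior_subset hx))).1
    exact mul_nonneg (by linarith) (exp_pos _).le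
  have hanti : AntitoneOn (fun x => (d x ^ 2 + e x ^ 2) * exp (-(1 + M) * x)) (Icc 0 L) := by
    refine antitoneOn_of_hasDerivWithinAt_nonpos (convex_Icc 0 L)
      (fun x hx => (hE _ x hx).continuousWithinAt)
      (fun x hx => (hE (-(1 + M)) x (interior_subset hx)).mono interior_subset) fun x hx => ?_
    have := (abs_le.1 (hbound x (interior_subset hx))).2
    exact mul_nonpos_of_nonpos_of_nonneg (by linarith) (exp_pos _).le
  intro x hx
  have key : ∀ k : ℝ, (d x ^ 2 + e x ^ 2) * exp (k * x) ≤ 0 → d x = 0 := fun k h => by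
    have h1 : d x ^ 2 + e x ^ 2 ≤ 0 := nonpos_of_mul_nonpos_left h (exp_pos _)
    exact pow_eq_zero_iff two_ne_zero |>.1
      (le_antisymm (by linarith [sq_nonneg (e x)]) (sq_nonneg (d x)))
  rcases le_total x x₀ with h | h
  · exact key _ ((hmono hx hx₀ h).trans (by simp [hd0, he0]))
  · exact key _ ((hanti hx₀ hx h).trans (by simp [hd0, he0]))

lemma eqOn_of_integrated_equation {a c L : ℝ} {u₁ v₁ u₂ v₂ : ℝ → ℝ}
    (hu₁ : ∀ x ∈ Icc 0 L, HasDerivWithinAt u₁ (v₁ x) (Icc 0 L) x)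
    (hv₁ : ∀ x ∈ Icc 0 L, HasDerivWithinAt v₁ (c - a * u₁ x - u₁ x ^ 2 / 2) (Icc 0 L) x)
    (hu₂ : ∀ x ∈ Icc 0 L, HasDerivWithinAt u₂ (v₂ x) (Icc 0 L) x)
    (hv₂ : ∀ x ∈ Icc 0 L, HasDerivWithinAt v₂ (c - a * u₂ x - u₂ x ^ 2 / 2) (Icc 0 L) x)
    {x₀ : ℝ} (hx₀ : x₀ ∈ Icc 0 L) (hu : u₁ x₀ = u₂ x₀) (hv : v₁ x₀ = v₂ x₀) :
    EqOn u₁ u₂ (Icc 0 L) := by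
  have hc₁ : ContinuousOn u₁ (Icc 0 L) := fun x hx => (hu₁ x hx).continuousWithinAt
  have hc₂ : ContinuousOn u₂ (Icc 0 L) := fun x hx => (hu₂ x hx).continuousWithinAt
  obtain ⟨M, hM⟩ := isCompact_Icc.exists_bound_of_continuousOn
    (show ContinuousOn (fun x => -(a + (u₁ x + u₂ x) / 2)) (Icc 0 L) by fun_prop)
  have := eqOn_zero_of_linear_second_order (d := fun x => u₁ x - u₂ x)
    (fun x hx => (hu₁ x hx).fun_sub (hu₂ x hx))
    (fun x hx => ((hv₁ x hx).fun_sub (hv₂ x hx)).congr_deriv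
      (show _ = -(a + (u₁ x + u₂ x) / 2) * (u₁ x - u₂ x) by ring))
    hM hx₀ (sub_eq_zero.2 hu) (sub_eq_zero.2 hv)
  exact fun x hx => sub_eq_zero.1 (this x hx)

/-! ### First integrals -/

lemma eq_right_of_hasDerivWithinAt_zero {L : ℝ} {f : ℝ → ℝ}
    (hf : ∀ x ∈ Icc 0 L, HasDerivWithinAt f 0 (Icc 0 L) x) : ∀ x ∈ Icc 0 L, f x = f L := by
  intro x hx
  have h0 : (0 : ℝ) ≤ L := hx.1.trans hx.2
  have := (convex_Icc 0 L).norm_image_sub_le_of_norm_hasDerivWithin_le (C := 0)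
    hf (by simp) hx ⟨h0, le_rfl⟩
  rw [zero_mul, norm_le_zero_iff, sub_eq_zero] at this
  exact this.symm

/-- The two integrations of the equation. -/
lemma IsStationaryKdVSolution.exists_integrals {a L : ℝ} (hL : 0 < L) {w : ℝ → ℝ}
    (h : IsStationaryKdVSolution a L w) :
    ∃ (c : ℝ) (v : ℝ → ℝ), (∀ x ∈ Icc 0 L, HasDerivWithinAt w (v x) (Icc 0 L) x) ∧
      (∀ x ∈ Icc 0 L, HasDerivWithinAt v (c - a * w x - w x ^ 2 / 2) (Icc 0 L) x) ∧
      ∀ x ∈ Icc 0 L, v x ^ 2 = w x * (2 * c - a * w x - w x ^ 2 / 3) := by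
  have hU := uniqueDiffOn_Icc hL
  set v := derivWithin w (Icc 0 L) with hv
  set z := derivWithin v (Icc 0 L) with hz
  have hvC : ContDiffOn ℝ 2 v (Icc 0 L) := h.contDiffOn.derivWithin hU (by norm_num)
  have hzC : ContDiffOn ℝ 1 z (Icc 0 L) := hvC.derivWithin hU (by norm_num)
  have hwd : ∀ x ∈ Icc 0 L, HasDerivWithinAt w (v x) (Icc 0 L) x := fun x hx =>
    (h.contDiffOn.differentiableOn (by norm_num) x hx).hasDerivWithinAt
  have hvd : ∀ x ∈ Icc 0 L, HasDerivWithinAt v (z x) (Icc 0 L) x := fun x hx =>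
    (hvC.differentiableOn (by norm_num) x hx).hasDerivWithinAt
  have hzd : ∀ x ∈ Icc 0 L, HasDerivWithinAt z (-(a * v x) - w x * v x) (Icc 0 L) x := by
    intro x hx
    refine (hzC.differentiableOn (by norm_num) x hx).hasDerivWithinAt.congr_deriv ?_
    have h3 := h.equation x hx
    have h4 : iteratedDerivWithin 3 w (Icc 0 L) x = derivWithin z (Icc 0 L) x := by
      rw [iteratedDerivWithin_succ]
      refine derivWithin_congr (fun y hy => ?_) ?_ <;>
      · rw [iteratedDerivWithin_succ]
        refine derivWithin_congr (fun y _ => ?_) ?_ <;> rw [iteratedDerivWithin_one]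
    rw [h4] at h3
    linarith
  have hInt := eq_right_of_hasDerivWithinAt_zero (L := L)
    (f := fun x => z x + a * w x + w x ^ 2 / 2) fun x hx =>
      (((hzd x hx).fun_add ((hwd x hx).const_mul a)).fun_add
        (((hwd x hx).fun_pow 2).div_const 2)).congr_deriv (by ring)
  generalize z L + a * w L + w L ^ 2 / 2 = c at hInt
  have hvd' : ∀ x ∈ Icc 0 L, HasDerivWithinAt v (c - a * w x - w x ^ 2 / 2) (Icc 0 L) x :=
    fun x hx => (hvd x hx).congr_deriv (by linarith [hInt x hx])
  refine ⟨c, v, hwd, hvd', fun x hx => ?_⟩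
  have hen := eq_right_of_hasDerivWithinAt_zero (L := L)
    (f := fun x => v x ^ 2 - 2 * c * w x + a * w x ^ 2 + w x ^ 3 / 3) (fun x hx =>
      (((((hvd' x hx).fun_pow 2).fun_sub ((hwd x hx).const_mul (2 * c))).fun_add
        (((hwd x hx).fun_pow 2).const_mul a)).fun_add
        (((hwd x hx).fun_pow 3).div_const 3)).congr_deriv (by ring)) x hx
  simp only [h.right_value, show v L = 0 from h.right_deriv] at hen
  linarith

lemma nonneg_endpoints_of_forall_Ioo {A ρ : ℝ} (h : ∀ t ∈ Ioo (0 : ℝ) 1, 0 ≤ A + ρ * t) :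
    0 ≤ A ∧ 0 ≤ A + ρ := by
  have hcl : IsClosed {t : ℝ | 0 ≤ A + ρ * t} := isClosed_le (by fun_prop) (by fun_prop)
  have := closure_minimal (s := Ioo (0 : ℝ) 1) h hcl
  rw [closure_Ioo zero_ne_one] at this
  have h0 : 0 ≤ A + ρ * 0 := this (left_mem_Icc.2 zero_le_one)
  have h1 : 0 ≤ A + ρ * 1 := this (right_mem_Icc.2 zero_le_one)
  constructor <;> linarith

/-- Every nontrivial solution has an admissible extremal value `ρ`, which determines the
constants of integration. -/
lemma IsStationaryKdVSolution.exists_amplitude {a L : ℝ} (hL : 0 < L) {w : ℝ → ℝ}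
    (h : IsStationaryKdVSolution a L w) (hne : ∃ x ∈ Icc 0 L, w x ≠ 0) :
    ∃ ρ ∈ admissibleAmplitudes a, ρ ≠ 0 ∧ ∃ v : ℝ → ℝ,
      (∀ x ∈ Icc 0 L, HasDerivWithinAt w (v x) (Icc 0 L) x) ∧
      (∀ x ∈ Icc 0 L,
        HasDerivWithinAt v (ρ * (ρ + 3 * a) / 6 - a * w x - w x ^ 2 / 2) (Icc 0 L) x) ∧
      v 0 = 0 := by
  obtain ⟨c, v, hw, hv, hen⟩ := h.exists_integrals hL
  have h0mem : (0 : ℝ) ∈ Icc 0 L := ⟨le_rfl, hL.le⟩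
  have hv0 : v 0 = 0 := by
    have := hen 0 h0mem
    rw [h.left_value, zero_mul] at this
    exact pow_eq_zero_iff two_ne_zero |>.1 this
  have hcont : ContinuousOn w (Icc 0 L) := fun x hx => (hw x hx).continuousWithinAt
  -- Maximizing `w²` rather than `w` treats both signs of `ρ` at once.
  obtain ⟨x₀, hx₀, hmax⟩ := isCompact_Icc.exists_isMaxOn ⟨0, h0mem⟩ (hcont.pow 2)
  have hρ0 : w x₀ ≠ 0 := by
    obtain ⟨x₁, hx₁, hne₁⟩ := hne
    have h1 : w x₁ ^ 2 ≤ w x₀ ^ 2 := hmax hx₁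
    have h2 : 0 < w x₁ ^ 2 := by positivity
    exact fun h3 => by rw [h3] at h1; linarith
  have hx₀0 : 0 < x₀ := hx₀.1.lt_of_ne fun h1 => hρ0 (h1 ▸ h.left_value)
  have hx₀L : x₀ < L := hx₀.2.lt_of_ne fun h1 => hρ0 (h1 ▸ h.right_value)
  have hvx₀ : v x₀ = 0 := by
    have hnhds := Icc_mem_nhds hx₀0 hx₀L
    have h1 := ((hw x₀ hx₀).hasDerivAt hnhds).fun_pow 2
    have h2 := (hmax.isLocalMax hnhds).hasDerivAt_eq_zero h1
    simpa [hρ0] using h2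
  set ρ := w x₀ with hρ
  have hc : c = ρ * (ρ + 3 * a) / 6 := by
    have h1 := hen x₀ hx₀
    rw [hvx₀, ← hρ, zero_pow two_ne_zero, zero_eq_mul, or_iff_right hρ0] at h1
    linarith
  -- By continuity `w` takes every value `ρ t`; there the energy identity reads `v² = ρ² t (1 - t)
  -- (3a + ρ + ρ t) / 3`.
  have hnn : 0 ≤ (3 * a + ρ) ∧ 0 ≤ (3 * a + ρ) + ρ := by
    refine nonneg_endpoints_of_forall_Ioo fun t ht => ?_
    have hsub : uIcc 0 x₀ ⊆ Icc 0 L := by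
      rw [uIcc_of_le hx₀.1]
      exact Icc_subset_Icc_right hx₀.2
    have hmem : ρ * t ∈ uIcc (w 0) (w x₀) := by
      rw [h.left_value, ← hρ, mem_uIcc]
      rcases hρ0.lt_or_gt with hneg | hpos
      · right; constructor <;> nlinarith [ht.1, ht.2]
      · left; constructor <;> nlinarith [ht.1, ht.2]
    obtain ⟨y, hy, hyt⟩ := intermediate_value_uIcc (hcont.mono hsub) hmem
    have h1 := hen y (hsub hy)
    rw [hyt, hc] at h1
    have h2 : 0 < ρ ^ 2 * (t * (1 - t)) :=
      mul_pos (by positivity) (mul_pos ht.1 (sub_pos.2 ht.2))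
    refine nonneg_of_mul_nonneg_right (a := ρ ^ 2 * (t * (1 - t))) ?_ h2
    nlinarith [sq_nonneg (v y)]
  rw [hc] at hv
  -- In the borderline cases `0` (if `A = 0`) or `ρ` (if `B = 0`) is an equilibrium, and uniqueness
  -- would make `w` constant, contradicting `w 0 = 0 ≠ ρ`.
  have hA : 3 * a + ρ ≠ 0 := fun hA => by
    refine hρ0 (eqOn_of_integrated_equation (u₂ := fun _ => 0) (v₂ := fun _ => 0) hw hv
      (fun x _ => hasDerivWithinAt_const _ _ _)
      (fun x _ => (hasDerivWithinAt_const _ _ _).congr_deriv ?_) h0mem h.left_value hv0 hx₀)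
    linear_combination -ρ / 6 * hA
  have hB : 3 * a + 2 * ρ ≠ 0 := fun hB => by
    have := eqOn_of_integrated_equation (u₂ := fun _ => ρ) (v₂ := fun _ => 0) hw hv
      (fun x _ => hasDerivWithinAt_const _ _ _)
      (fun x _ => (hasDerivWithinAt_const _ _ _).congr_deriv
        (by linear_combination ρ / 6 * hB)) hx₀ rfl hvx₀ h0mem
    exact hρ0 (this.symm.trans h.left_value)
  exact ⟨ρ, ⟨hnn.1.lt_of_ne' hA, lt_of_le_of_ne (by linarith) hB.symm⟩, hρ0, v, hw, hv, hv0⟩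

/-! ### Fundamental solutions -/

/-- A fundamental solution is the profile of an amplitude whose period is `L`. -/
lemma IsFundamentalKdVSolution.exists_amplitude {a L : ℝ} (hL : 0 < L) {w : ℝ → ℝ}
    (h : IsFundamentalKdVSolution a L w) :
    ∃ ρ ∈ admissibleAmplitudes a, ρ ≠ 0 ∧ phasePeriod (3 * a + ρ) (3 * a + 2 * ρ) = L ∧
      ∃ v : ℝ → ℝ, (∀ x ∈ Icc 0 L, HasDerivWithinAt w (v x) (Icc 0 L) x) ∧
        (∀ x ∈ Icc 0 L,
          HasDerivWithinAt v (ρ * (ρ + 3 * a) / 6 - a * w x - w x ^ 2 / 2) (Icc 0 L) x) ∧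
        v 0 = 0 := by
  obtain ⟨ρ, hρ, hρ0, v, hw, hv, hv0⟩ := h.solution.exists_amplitude hL h.nontrivial
  refine ⟨ρ, hρ, hρ0, ?_, v, hw, hv, hv0⟩
  obtain ⟨u, u', hu, hu', hu0, hu'0, hper, -, hne⟩ := exists_profile hρ hρ0
  have hT := phasePeriod_pos hρ.1 hρ.2
  set T := phasePeriod (3 * a + ρ) (3 * a + 2 * ρ)
  have heq : EqOn w u (Icc 0 L) := eqOn_of_integrated_equation hw hv
    (fun x _ => (hu x).hasDerivWithinAt) (fun x _ => (hu' x).hasDerivWithinAt)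
    (left_mem_Icc.2 hL.le) (h.solution.left_value.trans hu0.symm) (hv0.trans hu'0.symm)
  have huL : u L = 0 := (heq (right_mem_Icc.2 hL.le)).symm.trans h.solution.right_value
  -- The profile has no zero strictly inside a period, so `u L = 0` forces `L` to be a multiple of
  -- `T`; minimality of the period then gives `T = L`.
  have hLT : L - ⌊L / T⌋ * T = 0 := by
    by_contra hne0
    have h1 : L - ⌊L / T⌋ * T = T * Int.fract (L / T) := by
      rw [Int.fract]
      field_simp
    have h2 : 0 ≤ T * Int.fract (L / T) := mul_nonneg hT.le (Int.fract_nonneg _)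
    refine hne _ (lt_of_le_of_ne (h1 ▸ h2) (Ne.symm hne0)) ?_ ((hper.sub_int_mul_eq _).trans huL)
    rw [h1]
    exact mul_lt_of_lt_one_right hT (Int.fract_lt_one _)
  have hperL : Function.Periodic u L := by
    rw [sub_eq_zero.1 hLT]
    exact hper.int_mul _
  have hfund := h.fundamentalPeriod
  rw [periodicExtension_eq hL hperL heq] at hfund
  exact (isFundamentalPeriod_of_ne_zero hT hper hu0 hne).unique hfund

lemma exists_isFundamentalKdVSolution {a L ρ : ℝ} (hL : 0 < L) (hρ : ρ ∈ admissibleAmplitudes a)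
    (hρ0 : ρ ≠ 0) (hT : phasePeriod (3 * a + ρ) (3 * a + 2 * ρ) = L) :
    ∃ u : ℝ → ℝ, IsFundamentalKdVSolution a L u := by
  obtain ⟨u, v, hu, hv, hu0, hv0, hper, hperv, hne⟩ := exists_profile hρ hρ0
  rw [hT] at hper hperv hne
  refine ⟨u, isStationaryKdVSolution_of_hasDerivAt hL hu hv hu0 (hper.eq.trans hu0)
    (hperv.eq.trans hv0), ⟨L / 2, ⟨by linarith, by linarith⟩,
    hne _ (by linarith) (by linarith)⟩, ?_⟩
  rw [periodicExtension_eq hL hper (eqOn_refl u _)]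
  exact isFundamentalPeriod_of_ne_zero hL hper hu0 hne

lemma IsFundamentalKdVSolution.eqOn {a L : ℝ} (hL : 0 < L) {u w : ℝ → ℝ}
    (hw : IsFundamentalKdVSolution a L w) (hu : IsFundamentalKdVSolution a L u) :
    EqOn w u (Icc 0 L) := by
  obtain ⟨ρ, hρ, -, hT, v, hw1, hv, hv0⟩ := hw.exists_amplitude hL
  obtain ⟨ρ', hρ', -, hT', v', hu1, hv', hv0'⟩ := hu.exists_amplitude hL
  obtain rfl : ρ = ρ' := (phasePeriod_strictAntiOn a).injOn hρ hρ' (hT.trans hT'.symm)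
  exact eqOn_of_integrated_equation hw1 hv hu1 hv' (left_mem_Icc.2 hL.le)
    (hw.solution.left_value.trans hu.solution.left_value.symm) (hv0.trans hv0'.symm)

theorem theorem1 (a L : ℝ) (hL : 0 < L) :
    (a * L ^ 2 ≠ 4 * Real.pi ^ 2 →
      ∃ u : ℝ → ℝ, IsFundamentalKdVSolution a L u ∧
        ∀ w : ℝ → ℝ, IsFundamentalKdVSolution a L w → EqOn w u (Icc 0 L)) ∧
    (a * L ^ 2 = 4 * Real.pi ^ 2 →
      ¬ ∃ u : ℝ → ℝ, IsFundamentalKdVSolution a L u) := by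
  refine ⟨fun hne => ?_, ?_⟩
  · obtain ⟨ρ, hρ, hT⟩ := exists_admissible_phasePeriod_eq a hL
    have hρ0 : ρ ≠ 0 := by
      rintro rfl
      exact hne ((phasePeriod_zero_amplitude_eq_iff (by linarith [hρ.1]) hL).1 hT)
    obtain ⟨u, hu⟩ := exists_isFundamentalKdVSolution hL hρ hρ0 hT
    exact ⟨u, hu, fun w hw => hw.eqOn hL hu⟩
  · rintro heq ⟨u, hu⟩
    obtain ⟨ρ, hρ, hρ0, hT, -⟩ := hu.exists_amplitude hL
    have ha : 0 < a := by
      have h1 : 0 < a * L ^ 2 := by rw [heq]; positivity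
      exact pos_of_mul_pos_left h1 (by positivity)
    have h0 : (0 : ℝ) ∈ admissibleAmplitudes a := ⟨by linarith, by linarith⟩
    exact hρ0 ((phasePeriod_strictAntiOn a).injOn hρ h0
      (hT.trans ((phasePeriod_zero_amplitude_eq_iff ha hL).2 heq).symm))
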